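/- Let $R>1$ be an integer and let $B,L\subset\mathbb Z$ be finite sets with $0\in B$, $0\in L$ and $\#B=\#L=N$, such that $(B,L)$ is a Hadamard pair, i.e. the matrix $\frac1{\sqrt N}\left(e^{2\pi i R^{-1}bl}\right)_{b\in B,\,l\in L}$ is unitary. For $b\in B$ and $l\in L$ put $\tau_b(x)=R^{-1}(x+b)$ and $\sigma_l(x)=R^{-1}(x+l)$. Let $X_B=\left\{\sum_{k\ge1}R^{-k}b_k : b_k\in B\right\}$ be the attractor of $(\tau_b)_{b\in B}$ and let $\mu$ be its invariant measure, the unique Borel probability measure on $\mathbb R$ with $\mu(E)=\frac1N\sum_{b\in B}\mu(\tau_b^{-1}(E))$ for all Borel sets $E$; it is supported on $X_B$. Put $m_B(x)=\frac1N\sum_{b\in B}e^{2\pi i bx}$ and $m_L(x)=\frac1N\sum_{l\in L}e^{2\pi i lx}$. An $L$-cycle is a set $\{x_0,\dots,x_{p-1}\}\subset\mathbb R$, $p\ge1$, for which there are $l_0,\dots,l_{p-1}\in L$ with $\sigma_{l_i}(x_i)=x_{i+1}$ for $0\le i<p$, where $x_p:=x_0$; it is extreme if $|m_B(x_i)|=1$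 for all $i$. Let $\Lambda_0=\bigcup\{-C : C\text{ is an extreme }L\text{-cycle}\}$ and $\Lambda_{n+1}=R\Lambda_n+L$ for $n\ge0$; these are finite sets. Put $$D_n(x)=\sum_{\lambda\in\Lambda_n}e^{2\pi i\lambda x},\qquad s_n(f;x)=\sum_{\lambda\in\Lambda_n}\left(\int f(y)e^{-2\pi i\lambda y}\,d\mu(y)\right)e^{2\pi i\lambda x}\quad(f\in L^1(\mu)),$$ $$\Delta(Nm_L)=\exp\left(\int\log|Nm_L(x)|\,d\mu(x)\right).$$ **Theorem.** Suppose that $\Delta(Nm_L)>1$. Then: 1. For every $\rho$ with $1<\rho<\Delta(Nm_L)$ there is a constant $C>0$ such that $\|D_n\|_{L^1(\mu)}=\int|D_n(x)|\,d\mu(x)\ge C\rho^n$ for all sufficiently large $n$. 2. There is a $\mu$-integrable function $f$, continuous on $X_B$, whose partial Fourier sums at zero $s_n(f;0)$, $n\ge0$, are unbounded. -/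

import Mathlib

open MeasureTheory Filter

namespace MockFourier

noncomputable section

/-- The exponential function `e_t(x) = exp(2 π i t x)`. -/
def expo (t x : ℝ) : ℂ := Complex.exp (2 * Real.pi * Complex.I * (t * x : ℝ))

/-- The map `x ↦ R⁻¹ (x + s)`; it is `τ_b` for `s = b ∈ B` and `σ_l` for `s = l ∈ L`. -/
def contr (R : ℕ) (s : ℤ) (x : ℝ) : ℝ := (R : ℝ)⁻¹ * (x + s)

/-- The attractor `{∑_{k ≥ 1} R^{-k} b_k : b_k ∈ B}` of the system `(τ_b)_{b ∈ B}`. -/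
def attractor (R : ℕ) (B : Finset ℤ) : Set ℝ :=
  {x | ∃ b : ℕ → ℤ, (∀ k, b k ∈ B) ∧ HasSum (fun k => (b k : ℝ) / (R : ℝ) ^ (k + 1)) x}

/-- The invariance equation `μ(E) = (1/N) ∑_{b ∈ B} μ(τ_b⁻¹(E))` for all Borel sets `E`.
For `R > 1` and `B` non-empty exactly one Borel probability measure satisfies it. -/
def IsInvariantMeasure (R : ℕ) (B : Finset ℤ) (μ : Measure ℝ) : Prop :=
  ∀ E : Set ℝ, MeasurableSet E →
    μ E = (B.card : ENNReal)⁻¹ * ∑ b ∈ B, μ (contr R b ⁻¹' E)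

/-- The matrix `N^{-1/2} (exp(2 π i R⁻¹ b l))_{b ∈ B, l ∈ L}`, where `N = #B`. -/
def hadamardMatrix (R : ℕ) (B L : Finset ℤ) : Matrix B L ℂ :=
  Matrix.of fun b l => ((1 / Real.sqrt B.card : ℝ) : ℂ) * expo ((R : ℝ)⁻¹ * (b : ℤ)) (l : ℤ)

/-- `(B, L)` form a Hadamard pair (with respect to `R`). -/
structure IsHadamardPair (R : ℕ) (B L : Finset ℤ) : Prop where
  card_eq : B.card = L.card
  zero_mem_left : (0 : ℤ) ∈ B
  zero_mem_right : (0 : ℤ) ∈ L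
  mul_conjTranspose : hadamardMatrix R B L * (hadamardMatrix R B L).conjTranspose = 1
  conjTranspose_mul : (hadamardMatrix R B L).conjTranspose * hadamardMatrix R B L = 1

/-- The trigonometric polynomial `m_S(x) = (1/#S) ∑_{s ∈ S} exp(2 π i s x)`
(it is `m_B` for `S = B` and `m_L` for `S = L`). -/
def mask (S : Finset ℤ) (x : ℝ) : ℂ := (S.card : ℂ)⁻¹ * ∑ s ∈ S, expo s x

/-- `C = {x_0, …, x_{p-1}}`, `p ≥ 1`, is an `L`-cycle: there are `l_0, …, l_{p-1} ∈ L` with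
`σ_{l_i}(x_i) = x_{i+1}` for `i < p`, where `x_p = x_0`. -/
def IsCycle (R : ℕ) (L : Finset ℤ) (C : Set ℝ) : Prop :=
  ∃ (p : ℕ) (x : ℕ → ℝ) (l : ℕ → ℤ), 0 < p ∧ C = x '' Set.Iio p ∧ x p = x 0 ∧
    ∀ i < p, l i ∈ L ∧ contr R (l i) (x i) = x (i + 1)

/-- An `L`-cycle is extreme if `|m_B| = 1` at all its points. -/
def IsExtremeCycle (R : ℕ) (B L : Finset ℤ) (C : Set ℝ) : Prop :=
  IsCycle R L C ∧ ∀ y ∈ C, ‖mask B y‖ = 1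

/-- `Λ_0` is the union of the sets `-C` over all extreme `L`-cycles `C`, and
`Λ_{n+1} = R Λ_n + L`. -/
def freq (R : ℕ) (B L : Finset ℤ) : ℕ → Set ℝ
  | 0 => {y | ∃ C, IsExtremeCycle R B L C ∧ -y ∈ C}
  | n + 1 => {y | ∃ t ∈ freq R B L n, ∃ l ∈ L, y = (R : ℝ) * t + (l : ℝ)}

/-- The Dirichlet kernel `D_n(x) = ∑_{λ ∈ Λ_n} exp(2 π i λ x)`; the set `Λ_n` is finite,
see `freq_finite` below. -/
def dirichlet (R : ℕ) (B L : Finset ℤ) (n : ℕ) (x : ℝ) : ℂ :=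
  ∑ᶠ t ∈ freq R B L n, expo t x

/-- The partial Fourier sum
`s_n(f; x) = ∑_{λ ∈ Λ_n} (∫ f(y) exp(-2 π i λ y) dμ(y)) exp(2 π i λ x)`. -/
def partialSum (R : ℕ) (B L : Finset ℤ) (μ : Measure ℝ) (n : ℕ) (f : ℝ → ℂ) (x : ℝ) : ℂ :=
  ∑ᶠ t ∈ freq R B L n, (∫ y, f y * expo (-t) y ∂μ) * expo t x

/-- `Δ(g) = exp (∫ log |g| dμ)`. -/
def geomMean (μ : Measure ℝ) (g : ℝ → ℂ) : ℝ := Real.exp (∫ x, Real.log ‖g x‖ ∂μ)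

theorem norm_expo (t x : ℝ) : ‖expo t x‖ = 1 := by
  have : (2 * Real.pi * Complex.I * (t * x : ℝ) : ℂ)
      = ((2 * Real.pi * (t * x) : ℝ) : ℂ) * Complex.I := by
    push_cast; ring
  rw [expo, this, Complex.norm_exp_ofReal_mul_I]

theorem eq_one_of_norm_one_add (z : ℂ) (hz : ‖z‖ = 1) (h : 2 ≤ ‖1 + z‖) : z = 1 := by
  have h1 : z.re * z.re + z.im * z.im = 1 := by
    rw [← Complex.normSq_apply, Complex.normSq_eq_norm_sq, hz]; norm_num
  have h2 : (4 : ℝ) ≤ (1 + z).re * (1 + z).re + (1 + z).im * (1 + z).im := by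
    rw [← Complex.normSq_apply, Complex.normSq_eq_norm_sq]; nlinarith
  simp only [Complex.add_re, Complex.one_re, Complex.add_im, Complex.one_im] at h2
  have h3 : z.re = 1 := by nlinarith [mul_self_nonneg z.im]
  have h4 : z.im = 0 := by
    rw [h3] at h1
    have : z.im * z.im = 0 := by linarith
    simpa using this
  exact Complex.ext (by simpa using h3) (by simpa using h4)

/-- If `|m_B(y)| = 1` then `b y ∈ ℤ` for all `b ∈ B`. -/
theorem mul_mem_int {B : Finset ℤ} (h0 : (0 : ℤ) ∈ B) {b : ℤ} (hb : b ∈ B) {y : ℝ}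
    (hy : ‖mask B y‖ = 1) : ∃ k : ℤ, (b : ℝ) * y = k := by
  by_cases hb0 : b = 0
  · exact ⟨0, by simp [hb0]⟩
  have hN : (0 : ℝ) < B.card := by exact_mod_cast Finset.card_pos.2 ⟨0, h0⟩
  have hsum : ‖∑ s ∈ B, expo s y‖ = B.card := by
    rw [mask, norm_mul, norm_inv, Complex.norm_natCast] at hy
    field_simp at hy
    linarith
  have hb' : b ∈ B.erase 0 := Finset.mem_erase.2 ⟨hb0, hb⟩
  rw [← Finset.add_sum_erase B _ h0, ← Finset.add_sum_erase _ _ hb', ← add_assoc] at hsum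
  have hrest : ‖∑ s ∈ (B.erase 0).erase b, expo s y‖ ≤ B.card - 2 := by
    refine (norm_sum_le _ _).trans ?_
    simp only [norm_expo, Finset.sum_const, nsmul_eq_mul, mul_one]
    have e1 := Finset.card_erase_add_one h0
    have e2 := Finset.card_erase_add_one hb'
    have : (((B.erase 0).erase b).card : ℝ) + 2 = B.card := by
      rw [← e1, ← e2]; push_cast; ring
    linarith
  have htri := norm_add_le (expo ((0 : ℤ) : ℝ) y + expo b y)
    (∑ s ∈ (B.erase 0).erase b, expo s y)
  have hz : expo ((0 : ℤ) : ℝ) y = 1 := by simp [expo]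
  rw [hsum, hz] at htri
  have hone := eq_one_of_norm_one_add _ (norm_expo b y) (by linarith)
  rw [expo, Complex.exp_eq_one_iff] at hone
  obtain ⟨k, hk⟩ := hone
  refine ⟨k, ?_⟩
  have hpi : (2 * Real.pi * Complex.I : ℂ) ≠ 0 := Complex.two_pi_I_ne_zero
  have : (((b : ℝ) * y : ℝ) : ℂ) = ((k : ℝ) : ℂ) := by
    apply mul_left_cancel₀ hpi
    rw [hk]; push_cast; ring
  exact_mod_cast this

/-- Points of `L`-cycles are bounded by any bound of `L`. -/
theorem cycle_bound {R : ℕ} (hR : 1 < R) {L : Finset ℤ} {M : ℝ}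
    (hM : ∀ l ∈ L, |(l : ℝ)| ≤ M) {C : Set ℝ} (hC : IsCycle R L C) :
    ∀ y ∈ C, |y| ≤ M := by
  obtain ⟨p, x, l, hp, rfl, hx, hl⟩ := hC
  have hR2 : (2 : ℝ) ≤ R := by exact_mod_cast hR
  obtain ⟨j, hj, hmax⟩ := Finset.exists_max_image (Finset.range p) (fun i => |x i|)
    ⟨0, by simpa using hp⟩
  have hstep : ∀ i < p, (R : ℝ) * |x (i + 1)| ≤ |x i| + M := by
    intro i hi
    have h1 : (R : ℝ) * x (i + 1) = x i + l i := by
      rw [← (hl i hi).2, contr]; field_simp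
    have h2 : (R : ℝ) * |x (i + 1)| = |x i + l i| := by
      rw [← h1, abs_mul, abs_of_nonneg (by linarith : (0 : ℝ) ≤ R)]
    rw [h2]
    exact (abs_add_le _ _).trans (by linarith [hM _ (hl i hi).1])
  have hprev : ∃ i < p, x (i + 1) = x j := by
    rcases j with _ | j
    · exact ⟨p - 1, by omega, by rw [← hx]; congr 1; omega⟩
    · have := Finset.mem_range.1 hj
      exact ⟨j, by omega, rfl⟩
  obtain ⟨i, hi, hij⟩ := hprev
  have h1 := hstep i hi
  rw [hij] at h1
  have h2 : |x i| ≤ |x j| := hmax i (by simpa using hi)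
  have h3 : |x j| ≤ M := by nlinarith [abs_nonneg (x j)]
  rintro y ⟨k, hk, rfl⟩
  exact (hmax k (by simpa using hk)).trans h3

/-- The frequency sets `Λ_n` are finite, so that the sums over them are genuine sums. -/
theorem freq_finite {R : ℕ} (hR : 1 < R) {B L : Finset ℤ} (h : IsHadamardPair R B L) (n : ℕ) :
    (freq R B L n).Finite := by
  induction n with
  | zero =>
    by_cases hB : ∃ b ∈ B, b ≠ 0
    · obtain ⟨b, hb, hb0⟩ := hB
      obtain ⟨M, hM⟩ : ∃ M : ℝ, ∀ l ∈ L, |(l : ℝ)| ≤ M :=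
        ⟨∑ l ∈ L, |(l : ℝ)|, fun l hl =>
          Finset.single_le_sum (f := fun l : ℤ => |(l : ℝ)|) (fun _ _ => abs_nonneg _) hl⟩
      have hbR : (b : ℝ) ≠ 0 := by exact_mod_cast hb0
      refine ((Set.finite_Icc (-⌈|(b : ℝ)| * M⌉) ⌈|(b : ℝ)| * M⌉).image
        (fun k : ℤ => -((k : ℝ) / b))).subset ?_
      rintro y ⟨C, ⟨hC, hC1⟩, hy⟩
      obtain ⟨k, hk⟩ := mul_mem_int h.zero_mem_left hb (hC1 _ hy)
      have hyM := cycle_bound hR hM hC _ hy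
      have hkM : |(k : ℝ)| ≤ ⌈|(b : ℝ)| * M⌉ := by
        rw [← hk, abs_mul]
        exact (mul_le_mul_of_nonneg_left hyM (abs_nonneg _)).trans (Int.le_ceil _)
      have hkM' : |k| ≤ ⌈|(b : ℝ)| * M⌉ := by exact_mod_cast hkM
      refine ⟨k, ⟨(abs_le.1 hkM').1, (abs_le.1 hkM').2⟩, ?_⟩
      simp only
      rw [← hk]; field_simp
    · push Not at hB
      have hB1 : B = {0} := Finset.eq_singleton_iff_unique_mem.2 ⟨h.zero_mem_left, hB⟩
      have hcard : L.card = 1 := by rw [← h.card_eq, hB1]; simp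
      obtain ⟨a, ha⟩ := Finset.card_eq_one.1 hcard
      have hL : ∀ l ∈ L, |(l : ℝ)| ≤ 0 := by
        have h0 := h.zero_mem_right
        rw [ha, Finset.mem_singleton] at h0
        intro l hl
        rw [ha, Finset.mem_singleton] at hl
        simp [hl, ← h0]
      refine (Set.finite_singleton (0 : ℝ)).subset ?_
      rintro y ⟨C, ⟨hC, -⟩, hy⟩
      have := cycle_bound hR hL hC _ hy
      simpa using this
  | succ n ih =>
    refine ((ih.prod L.finite_toSet).image
      (fun q : ℝ × ℤ => (R : ℝ) * q.1 + (q.2 : ℝ))).subset ?_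
    rintro y ⟨t, ht, l, hl, rfl⟩
    exact ⟨(t, l), ⟨ht, by simpa using hl⟩, rfl⟩

/-- The fair product measure is unchanged when an independent fair digit is put in front. -/
theorem map_cons_infinitePi {α : Type} [MeasurableSpace α] (ν : Measure α)
    [IsProbabilityMeasure ν] :
    (ν.prod (Measure.infinitePi fun _ : ℕ => ν)).map
      (fun q n => Nat.casesOn n q.1 q.2 : α × (ℕ → α) → ℕ → α)
      = Measure.infinitePi fun _ : ℕ => ν := by
  classical
  have hmeas : Measurable (fun q n => Nat.casesOn n q.1 q.2 : α × (ℕ → α) → ℕ → α) := by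
    refine measurable_pi_lambda _ fun n => ?_
    cases n with
    | zero => exact measurable_fst
    | succ n => exact (measurable_pi_apply n).comp measurable_snd
  refine Measure.eq_infinitePi _ fun s t ht => ?_
  set u : ℕ → Set α := fun i => if i ∈ s then t i else Set.univ with hu
  have hum : ∀ i, MeasurableSet (u i) := fun i => by
    by_cases hi : i ∈ s <;> simp [hu, hi, ht i]
  obtain ⟨m, hm⟩ : ∃ m, s ⊆ Finset.range (m + 1) :=
    ⟨s.sup id, fun i hi => Finset.mem_range.2 (Nat.lt_succ_of_le (Finset.le_sup (f := id) hi))⟩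
  have hprod : ∏ i ∈ s, ν (t i) = ∏ i ∈ Finset.range (m + 1), ν (u i) := by
    rw [← Finset.prod_subset hm (f := fun i => ν (u i))]
    · exact Finset.prod_congr rfl fun i hi => by simp [hu, hi]
    · intro i _ hi; simp [hu, hi]
  rw [Measure.map_apply hmeas (MeasurableSet.pi s.countable_toSet fun i _ => ht i), hprod,
    Finset.prod_range_succ', ← Measure.infinitePi_pi (fun _ : ℕ => ν)
      (s := Finset.range m) (t := fun i => u (i + 1)) (fun i _ => hum _), mul_comm,
    ← Measure.prod_prod]
  congr 1
  ext ⟨a, w⟩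
  simp only [Set.mem_preimage, Set.mem_pi, Set.mem_prod, Finset.mem_coe]
  constructor
  · intro h
    refine ⟨?_, fun i _ => ?_⟩
    · by_cases hi : 0 ∈ s
      · simpa [hu, hi] using h 0 hi
      · simp [hu, hi]
    · by_cases hi : i + 1 ∈ s
      · simpa [hu, hi] using h (i + 1) hi
      · simp [hu, hi]
  · rintro ⟨h0, h1⟩ i hi
    cases i with
    | zero => simpa [hu, hi] using h0
    | succ i =>
      have := h1 i (by have := hm hi; simp at this ⊢; omega)
      simpa [hu, hi] using this

/-- There is an invariant probability measure. -/
theorem exists_invariantMeasure {R : ℕ} (hR : 1 < R) {B : Finset ℤ} (hB : B.Nonempty) :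
    ∃ μ : Measure ℝ, IsProbabilityMeasure μ ∧ IsInvariantMeasure R B μ := by
  classical
  have : Nonempty B := hB.to_subtype
  let ν : Measure B := (PMF.uniformOfFintype B).toMeasure
  have : IsProbabilityMeasure ν := PMF.toMeasure.isProbabilityMeasure _
  have hν : ν = (B.card : ENNReal)⁻¹ • ∑ b : B, Measure.dirac b := by
    ext s hs
    rw [PMF.toMeasure_apply_fintype]
    simp [Set.indicator_apply, hs, ← Finset.sum_filter, mul_comm]
  let P : Measure (ℕ → B) := Measure.infinitePi fun _ : ℕ => ν
  let E : (ℕ → B) → ℝ := fun w => ∑' k, ((w k : ℤ) : ℝ) / (R : ℝ) ^ (k + 1)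
  have hR0 : (0 : ℝ) < R := by exact_mod_cast (by omega : 0 < R)
  have hsum : ∀ w : ℕ → B, Summable fun k => ((w k : ℤ) : ℝ) / (R : ℝ) ^ (k + 1) := by
    intro w
    have hgeo : Summable fun k : ℕ => (∑ b ∈ B, |(b : ℝ)|) * ((R : ℝ)⁻¹) ^ (k + 1) := by
      refine Summable.mul_left _ ?_
      refine (summable_nat_add_iff 1).2 (summable_geometric_of_lt_one (by positivity) ?_)
      exact inv_lt_one_of_one_lt₀ (by exact_mod_cast hR)
    refine Summable.of_norm_bounded hgeo fun k => ?_
    rw [Real.norm_eq_abs, abs_div, div_eq_mul_inv, abs_of_pos (pow_pos hR0 _), inv_pow]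
    refine mul_le_mul_of_nonneg_right ?_ (by positivity)
    exact Finset.single_le_sum (f := fun l : ℤ => |(l : ℝ)|) (fun _ _ => abs_nonneg _) (w k).2
  have hE : Measurable E := by
    refine Measurable.tsum fun k => ?_
    exact ((measurable_of_countable fun b : B => ((b : ℤ) : ℝ)).comp
      (measurable_pi_apply k)).div_const _
  have hcons : ∀ (b : B) (w : ℕ → B),
      E (fun n => Nat.casesOn n b w) = contr R b (E w) := by
    intro b w
    have h1 := (hsum (fun n => Nat.casesOn n b w)).tsum_eq_zero_add
    simp only [E, contr]
    rw [h1, mul_add, ← tsum_mul_left, add_comm]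
    congr 1
    · refine tsum_congr fun k => ?_
      rw [pow_succ]; field_simp
    · simp; field_simp
  have hmeas : Measurable (fun q n => Nat.casesOn n q.1 q.2 : B × (ℕ → B) → ℕ → B) := by
    refine measurable_pi_lambda _ fun n => ?_
    cases n with
    | zero => exact measurable_fst
    | succ n => exact (measurable_pi_apply n).comp measurable_snd
  refine ⟨P.map E, Measure.isProbabilityMeasure_map hE.aemeasurable, fun S hS => ?_⟩
  have hc : ∀ b : ℤ, Measurable (contr R b) := fun b => by unfold contr; fun_prop
  conv_lhs => rw [show P = _ from (map_cons_infinitePi ν).symm]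
  rw [Measure.map_map hE hmeas, Measure.map_apply (hE.comp hmeas) hS,
    Measure.prod_apply ((hE.comp hmeas) hS), hν, lintegral_smul_measure,
    lintegral_finsetSum_measure, smul_eq_mul]
  congr 1
  simp only [lintegral_dirac]
  rw [← Finset.sum_coe_sort B]
  refine Finset.sum_congr rfl fun b _ => ?_
  rw [Measure.map_apply hE (hc b hS), ← hν]
  congr 1
  ext w
  simp [hcons]

end

end MockFourier

namespace MockFourier

open Topology

/-! The kernel is a Riesz-type product: `D_n(x) = ∏_{k<n} N m_L(R^k x) · D_0(R^n x)`. Write `g = log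
|N m_L|`. If `x ↦ R x` behaves like a mixing, measure-preserving map, the logarithm of the product
has mean `n ∫ g dμ = n log Δ(N m_L)`, and convexity of `exp` turns this mean into a lower bound for
the `L¹` norm. The last factor may be small, so the estimate is confined to those `x` for which `R^n
x` lies in `U = {|D_0| > 1/2}`. This open set contains `0`, hence has positive measure `m`. Mixing
shows that the restriction costs only the factor `m`: `∫ 1_U(R^n x) g(R^k x) dμ = ∫ 1_U(R^{n-k} x) g
dμ`, which tends to `m ∫ g dμ` as `n - k` grows, and averaging over `k` gives Cesàro convergence.

The measure lives on `ℝ`, and `x ↦ R x` preserves it only as seen by functions having every `b ∈ B`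
as a period. The functions `D_n` and `m_L` have these periods. On them composition with `R^n x` is
dual to the `n`-th iterate of the transfer operator, which averages over points contracted by
`R^{-n}` and so flattens every uniformly continuous function to its mean. This gives mixing
(`IsInvariantMeasure.tendsto_integral_comp_pow_mul`). Zeros of `m_L` do no harm because `μ` has no
atoms.

For divergence, `s_n(f; 0)` is the integral of `f` against the conjugate of `D_n`. The norms of
these functionals on bounded continuous functions are at least `‖D_n‖₁ - 1`, hence unbounded, and
the uniform boundedness principle applies. -/

/-- The transfer operator `(T h)(y) = (1/N) ∑_{b ∈ B} h(τ_b y)`. -/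
noncomputable def transfer (R : ℕ) (B : Finset ℤ) (h : ℝ → ℝ) (y : ℝ) : ℝ :=
  (B.card : ℝ)⁻¹ * ∑ b ∈ B, h (contr R b y)

theorem continuous_contr (R : ℕ) (s : ℤ) : Continuous (contr R s) := by
  unfold contr; fun_prop

theorem mul_contr {R : ℕ} (hR : 1 < R) (s : ℤ) (x : ℝ) : (R : ℝ) * contr R s x = x + s := by
  have : (R : ℝ) ≠ 0 := by exact_mod_cast (by omega : R ≠ 0)
  rw [contr]; field_simp

theorem card_inv_mul_sum_const {B : Finset ℤ} (hB : B.Nonempty) (c : ℝ) :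
    (B.card : ℝ)⁻¹ * ∑ _b ∈ B, c = c := by
  have : (B.card : ℝ) ≠ 0 := by exact_mod_cast hB.card_ne_zero
  simp only [Finset.sum_const, nsmul_eq_mul]
  field_simp

/-! ### Flattening of functions by the transfer operator. -/

section Transfer

variable {R : ℕ} {B : Finset ℤ} {h : ℝ → ℝ}

theorem continuous_transfer (hh : Continuous h) : Continuous (transfer R B h) := by
  unfold transfer
  exact continuous_const.mul (continuous_finsetSum _ fun b _ => hh.comp (continuous_contr R b))

theorem continuous_transfer_iterate (hh : Continuous h) (n : ℕ) :
    Continuous ((transfer R B)^[n] h) := by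
  induction n generalizing h with
  | zero => exact hh
  | succ n ih => exact ih (continuous_transfer hh)

theorem abs_transfer_le (hB : B.Nonempty) {C : ℝ} (hh : ∀ x, |h x| ≤ C) (x : ℝ) :
    |transfer R B h x| ≤ C := by
  rw [transfer, abs_mul, abs_of_nonneg (by positivity : (0 : ℝ) ≤ (B.card : ℝ)⁻¹)]
  refine le_of_le_of_eq ?_ (card_inv_mul_sum_const hB C)
  gcongr
  exact (Finset.abs_sum_le_sum_abs _ _).trans (Finset.sum_le_sum fun b _ => hh _)

theorem abs_transfer_iterate_le (hB : B.Nonempty) {C : ℝ} (hh : ∀ x, |h x| ≤ C) (n : ℕ)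
    (x : ℝ) : |(transfer R B)^[n] h x| ≤ C := by
  induction n generalizing h with
  | zero => exact hh x
  | succ n ih => exact ih (abs_transfer_le hB hh)

/-- Each `τ_b` divides distances by `R`, so the same oscillation bound `ε` holds at a scale `R`
times larger. -/
theorem abs_transfer_sub_le (hR : 1 < R) (hB : B.Nonempty) {δ ε : ℝ}
    (hh : ∀ x y, |x - y| ≤ δ → |h x - h y| ≤ ε) (x y : ℝ) (hxy : |x - y| ≤ R * δ) :
    |transfer R B h x - transfer R B h y| ≤ ε := by
  have hR0 : (0 : ℝ) < R := by exact_mod_cast (by omega : 0 < R)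
  rw [transfer, transfer, ← mul_sub, ← Finset.sum_sub_distrib, abs_mul,
    abs_of_nonneg (by positivity : (0 : ℝ) ≤ (B.card : ℝ)⁻¹)]
  refine le_of_le_of_eq ?_ (card_inv_mul_sum_const hB ε)
  gcongr
  refine (Finset.abs_sum_le_sum_abs _ _).trans (Finset.sum_le_sum fun b _ => hh _ _ ?_)
  have : contr R b x - contr R b y = (R : ℝ)⁻¹ * (x - y) := by simp only [contr]; ring
  rw [this, abs_mul, abs_of_pos (by positivity : (0 : ℝ) < (R : ℝ)⁻¹), inv_mul_le_iff₀ hR0]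
  exact hxy

theorem abs_transfer_iterate_sub_le (hR : 1 < R) (hB : B.Nonempty) {δ ε : ℝ} (n : ℕ)
    (hh : ∀ x y, |x - y| ≤ δ → |h x - h y| ≤ ε) (x y : ℝ) (hxy : |x - y| ≤ R ^ n * δ) :
    |(transfer R B)^[n] h x - (transfer R B)^[n] h y| ≤ ε := by
  induction n generalizing h δ with
  | zero => exact hh x y (by simpa using hxy)
  | succ n ih =>
    exact ih (δ := R * δ) (abs_transfer_sub_le hR hB hh) (by rw [pow_succ, mul_assoc] at hxy; exact hxy)

theorem tendsto_transfer_iterate_sub (hR : 1 < R) (hB : B.Nonempty) (hh : UniformContinuous h)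
    (x y : ℝ) :
    Tendsto (fun n => (transfer R B)^[n] h x - (transfer R B)^[n] h y) atTop (𝓝 0) := by
  rw [Metric.tendsto_atTop]
  intro ε hε
  obtain ⟨δ, hδ, H⟩ := Metric.uniformContinuous_iff.1 hh (ε / 2) (by positivity)
  have H' : ∀ x y, |x - y| ≤ δ / 2 → |h x - h y| ≤ ε / 2 := fun x y hxy => by
    have := H (a := x) (b := y) (by rw [Real.dist_eq]; linarith)
    rw [Real.dist_eq] at this
    exact this.le
  have hR1 : (1 : ℝ) < R := by exact_mod_cast hR
  obtain ⟨n₀, hn₀⟩ := pow_unbounded_of_one_lt (|x - y| / (δ / 2)) hR1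
  refine ⟨n₀, fun n hn => ?_⟩
  rw [dist_zero_right, Real.norm_eq_abs]
  refine lt_of_le_of_lt (abs_transfer_iterate_sub_le hR hB n H' x y ?_) (half_lt_self hε)
  have h1 : (R : ℝ) ^ n₀ ≤ (R : ℝ) ^ n := pow_le_pow_right₀ hR1.le hn
  have h2 := (div_lt_iff₀ (by positivity : (0 : ℝ) < δ / 2)).1 hn₀
  nlinarith

end Transfer

/-! ### Invariance, mixing and absence of atoms. -/

section Invariant

variable {R : ℕ} {B : Finset ℤ} {μ : Measure ℝ}

theorem IsInvariantMeasure.eq_smul_sum_map (hμ : IsInvariantMeasure R B μ) :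
    μ = (B.card : ENNReal)⁻¹ • ∑ b ∈ B, μ.map (contr R b) := by
  ext E hE
  rw [hμ E hE, Measure.smul_apply, Measure.finsetSum_apply, smul_eq_mul]
  congr 1
  exact Finset.sum_congr rfl fun b _ => (Measure.map_apply (continuous_contr R b).measurable hE).symm

theorem IsInvariantMeasure.null_preimage (hμ : IsInvariantMeasure R B μ) {E : Set ℝ}
    (hE : MeasurableSet E) (h0 : μ E = 0) {b : ℤ} (hb : b ∈ B) : μ (contr R b ⁻¹' E) = 0 := by
  rw [hμ E hE, mul_eq_zero, Finset.sum_eq_zero_iff] at h0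
  exact h0.resolve_left (by simp) b hb

theorem IsInvariantMeasure.integrable_comp_contr (hμ : IsInvariantMeasure R B μ) (hB : B.Nonempty)
    {h : ℝ → ℝ} (hh : Integrable h μ) {b : ℤ} (hb : b ∈ B) :
    Integrable (fun y => h (contr R b y)) μ := by
  rw [hμ.eq_smul_sum_map, integrable_smul_measure (by simp) (by simpa using hB.ne_empty),
    integrable_finsetSum_measure] at hh
  exact (hh b hb).comp_measurable (continuous_contr R b).measurable

theorem IsInvariantMeasure.integral_eq (hμ : IsInvariantMeasure R B μ) (hB : B.Nonempty)
    {h : ℝ → ℝ} (hh : Integrable h μ) : ∫ x, h x ∂μ = ∫ y, transfer R B h y ∂μ := by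
  have hh' := hh
  rw [hμ.eq_smul_sum_map, integrable_smul_measure (by simp) (by simpa using hB.ne_empty),
    integrable_finsetSum_measure] at hh'
  conv_lhs => rw [hμ.eq_smul_sum_map]
  rw [integral_smul_measure, integral_finsetSum_measure hh']
  unfold transfer
  rw [integral_const_mul, integral_finsetSum _ fun b hb => hμ.integrable_comp_contr hB hh hb]
  simp only [ENNReal.toReal_inv, ENNReal.toReal_natCast, smul_eq_mul]
  congr 1
  refine Finset.sum_congr rfl fun b hb => ?_
  rw [integral_map (continuous_contr R b).aemeasurable (hh' b hb).1]

theorem IsInvariantMeasure.integrable_transfer (hμ : IsInvariantMeasure R B μ) (hB : B.Nonempty)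
    {h : ℝ → ℝ} (hh : Integrable h μ) : Integrable (transfer R B h) μ :=
  (integrable_finsetSum _ fun _ hb => hμ.integrable_comp_contr hB hh hb).const_mul _

/-- Since `R τ_b(y) = y + b`, the factor `F(R ·)` takes the value `F y` on every branch and leaves
the average. -/
theorem transfer_comp_mul (hR : 1 < R) {F h : ℝ → ℝ}
    (hF : ∀ b ∈ B, Function.Periodic F (b : ℝ)) (y : ℝ) :
    transfer R B (fun x => F (R * x) * h x) y = F y * transfer R B h y := by
  have : ∀ b ∈ B, F (R * contr R b y) * h (contr R b y) = F y * h (contr R b y) := by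
    intro b hb
    rw [mul_contr hR, hF b hb]
  simp only [transfer]
  rw [Finset.sum_congr rfl this, ← Finset.mul_sum]
  ring

theorem periodic_comp_pow_mul {F : ℝ → ℝ} {c : ℝ} (hF : Function.Periodic F c) (n : ℕ) :
    Function.Periodic (fun x => F ((R : ℝ) ^ n * x)) c := by
  intro x
  have := (hF.nat_mul (R ^ n)) ((R : ℝ) ^ n * x)
  rw [Nat.cast_pow, ← mul_add] at this
  exact this

/-- Composition with `x ↦ Rⁿ x` is dual to the `n`-th iterate of the transfer operator. -/
theorem IsInvariantMeasure.integral_comp_pow_mul (hR : 1 < R) (hμ : IsInvariantMeasure R B μ)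
    (hB : B.Nonempty) {F h : ℝ → ℝ} (hF : ∀ b ∈ B, Function.Periodic F (b : ℝ))
    (hFm : Measurable F) {C : ℝ} (hFC : ∀ x, ‖F x‖ ≤ C) (hh : Integrable h μ) (n : ℕ) :
    ∫ x, F ((R : ℝ) ^ n * x) * h x ∂μ = ∫ y, F y * (transfer R B)^[n] h y ∂μ := by
  induction n generalizing h with
  | zero => simp
  | succ n ih =>
    rw [Function.iterate_succ_apply, ← ih (hμ.integrable_transfer hB hh)]
    have hint : Integrable (fun x => F ((R : ℝ) ^ n * (R * x)) * h x) μ :=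
      hh.bdd_mul (by fun_prop : Measurable _).aestronglyMeasurable (Eventually.of_forall fun x => hFC _)
    simp only [pow_succ, mul_assoc]
    rw [hμ.integral_eq hB hint]
    refine integral_congr_ae (Eventually.of_forall fun y => ?_)
    exact transfer_comp_mul hR (F := fun x => F ((R : ℝ) ^ n * x))
      (fun b hb => periodic_comp_pow_mul (hF b hb) n) y

theorem IsInvariantMeasure.integrable_comp_mul (hR : 1 < R) (hμ : IsInvariantMeasure R B μ)
    (hB : B.Nonempty) {F : ℝ → ℝ} (hF : ∀ b ∈ B, Function.Periodic F (b : ℝ))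
    (hFm : Measurable F) (hFi : Integrable F μ) :
    Integrable (fun x => F (R * x)) μ := by
  rw [hμ.eq_smul_sum_map, integrable_smul_measure (by simp) (by simpa using hB.ne_empty),
    integrable_finsetSum_measure]
  intro b hb
  have hm : Measurable fun x => F (R * x) := by fun_prop
  rw [integrable_map_measure hm.aestronglyMeasurable (continuous_contr R b).aemeasurable]
  refine hFi.congr (Eventually.of_forall fun x => ?_)
  simp only [Function.comp, mul_contr hR]
  exact (hF b hb x).symm

/-- The transfer operator sends `F(R ·)` back to `F`, by periodicity; this is the sense in which `x
↦ R x` preserves `μ`. -/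
theorem IsInvariantMeasure.integral_comp_mul (hR : 1 < R) (hμ : IsInvariantMeasure R B μ)
    (hB : B.Nonempty) {F : ℝ → ℝ} (hF : ∀ b ∈ B, Function.Periodic F (b : ℝ))
    (hFm : Measurable F) (hFi : Integrable F μ) :
    ∫ x, F (R * x) ∂μ = ∫ x, F x ∂μ := by
  rw [hμ.integral_eq hB (hμ.integrable_comp_mul hR hB hF hFm hFi)]
  refine integral_congr_ae (Eventually.of_forall fun y => ?_)
  have := transfer_comp_mul hR (h := fun _ => 1) hF y
  simp only [mul_one] at this
  rw [this, transfer, card_inv_mul_sum_const hB, mul_one]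

theorem IsInvariantMeasure.integrable_and_integral_comp_pow_mul (hR : 1 < R) (hμ : IsInvariantMeasure R B μ)
    (hB : B.Nonempty) {F : ℝ → ℝ} (hF : ∀ b ∈ B, Function.Periodic F (b : ℝ))
    (hFm : Measurable F) (hFi : Integrable F μ) (n : ℕ) :
    Integrable (fun x => F ((R : ℝ) ^ n * x)) μ ∧
      ∫ x, F ((R : ℝ) ^ n * x) ∂μ = ∫ x, F x ∂μ := by
  induction n with
  | zero => simpa using hFi
  | succ n ih =>
    have hP : ∀ b ∈ B, Function.Periodic (fun x => F ((R : ℝ) ^ n * x)) (b : ℝ) :=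
      fun b hb => periodic_comp_pow_mul (hF b hb) n
    have hm : Measurable fun x => F ((R : ℝ) ^ n * x) := by fun_prop
    simp only [pow_succ, mul_assoc]
    exact ⟨hμ.integrable_comp_mul hR hB hP hm ih.1,
      (hμ.integral_comp_mul hR hB hP hm ih.1).trans ih.2⟩

theorem IsInvariantMeasure.integral_transfer_iterate (hμ : IsInvariantMeasure R B μ)
    (hB : B.Nonempty) {h : ℝ → ℝ} (hh : Integrable h μ) (n : ℕ) :
    Integrable ((transfer R B)^[n] h) μ ∧ ∫ x, (transfer R B)^[n] h x ∂μ = ∫ x, h x ∂μ := by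
  induction n generalizing h with
  | zero => exact ⟨hh, rfl⟩
  | succ n ih =>
    have := ih (hμ.integrable_transfer hB hh)
    rw [← hμ.integral_eq hB hh] at this
    exact this

variable [IsProbabilityMeasure μ]

/-- The iterates become constant in the limit and all have the same integral, so the constant is
that integral. -/
theorem IsInvariantMeasure.tendsto_transfer_iterate (hR : 1 < R) (hμ : IsInvariantMeasure R B μ)
    (hB : B.Nonempty) {h : ℝ → ℝ} (hh : UniformContinuous h) {C : ℝ} (hC : ∀ x, |h x| ≤ C)
    (y : ℝ) : Tendsto (fun n => (transfer R B)^[n] h y) atTop (𝓝 (∫ x, h x ∂μ)) := by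
  have hi : Integrable h μ := Integrable.of_bound hh.continuous.aestronglyMeasurable C
    (Eventually.of_forall hC)
  have key : Tendsto (fun n => ∫ x, ((transfer R B)^[n] h y - (transfer R B)^[n] h x) ∂μ) atTop
      (𝓝 (∫ _x, (0 : ℝ) ∂μ)) := by
    refine tendsto_integral_of_dominated_convergence (fun _ => C + C) (fun n => ?_)
      (integrable_const _) (fun n => Eventually.of_forall fun x => ?_)
      (Eventually.of_forall fun x => tendsto_transfer_iterate_sub hR hB hh y x)
    · exact (continuous_const.sub (continuous_transfer_iterate hh.continuous n)).aestronglyMeasurable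
    · exact (norm_sub_le _ _).trans (add_le_add (abs_transfer_iterate_le hB hC n y)
        (abs_transfer_iterate_le hB hC n x))
  have heq : ∀ n, ∫ x, ((transfer R B)^[n] h y - (transfer R B)^[n] h x) ∂μ
      = (transfer R B)^[n] h y - ∫ x, h x ∂μ := by
    intro n
    have := hμ.integral_transfer_iterate hB hi n
    rw [integral_sub (integrable_const _) this.1, this.2]
    simp
  simp only [heq, integral_zero] at key
  simpa using key.add_const (∫ x, h x ∂μ)

/-- Mixing of `x ↦ R x` with respect to an invariant measure. -/
theorem IsInvariantMeasure.tendsto_integral_comp_pow_mul (hR : 1 < R)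
    (hμ : IsInvariantMeasure R B μ) (hB : B.Nonempty) {F g : ℝ → ℝ}
    (hF : ∀ b ∈ B, Function.Periodic F (b : ℝ)) (hFm : Measurable F) (hF1 : ∀ x, ‖F x‖ ≤ 1)
    (hg : Integrable g μ) :
    Tendsto (fun n : ℕ => ∫ x, F ((R : ℝ) ^ n * x) * g x ∂μ) atTop
      (𝓝 ((∫ x, F x ∂μ) * ∫ x, g x ∂μ)) := by
  have hFi : Integrable F μ := Integrable.of_bound hFm.aestronglyMeasurable 1
    (Eventually.of_forall hF1)
  have hF1' : |∫ x, F x ∂μ| ≤ 1 := by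
    have := norm_integral_le_of_norm_le_const (μ := μ) (Eventually.of_forall hF1)
    simpa using this
  rw [Metric.tendsto_atTop]
  intro ε hε
  -- Only `g` is approximated in `L¹`; `F` may stay merely measurable, because duality moves the
  -- whole dynamics onto `h`.
  obtain ⟨h, hsupp, hgh, hcont, hhi⟩ :=
    hg.exists_hasCompactSupport_integral_sub_le (ε := ε / 4) (by positivity)
  obtain ⟨C, hC⟩ := hcont.bounded_above_of_compact_support hsupp
  have hlim : Tendsto (fun n : ℕ => ∫ x, F ((R : ℝ) ^ n * x) * h x ∂μ) atTop
      (𝓝 ((∫ x, F x ∂μ) * ∫ x, h x ∂μ)) := by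
    simp_rw [hμ.integral_comp_pow_mul hR hB hF hFm hF1 hhi]
    rw [← integral_mul_const]
    refine tendsto_integral_of_dominated_convergence (fun _ => 1 * C) (fun n => ?_)
      (integrable_const _) (fun n => Eventually.of_forall fun x => ?_)
      (Eventually.of_forall fun x => tendsto_const_nhds.mul
        (hμ.tendsto_transfer_iterate hR hB (hsupp.uniformContinuous_of_continuous hcont) hC x))
    · exact hFm.aestronglyMeasurable.mul
        (continuous_transfer_iterate hcont n).aestronglyMeasurable
    · rw [norm_mul]
      exact mul_le_mul (hF1 x) (abs_transfer_iterate_le hB hC n x) (norm_nonneg _) zero_le_one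
  obtain ⟨n₀, hn₀⟩ := Metric.tendsto_atTop.1 hlim (ε / 4) (by positivity)
  refine ⟨n₀, fun n hn => ?_⟩
  have h1 := hn₀ n hn
  rw [Real.dist_eq] at h1 ⊢
  have hbm : ∀ k : ℝ → ℝ, Integrable k μ → Integrable (fun x => F ((R : ℝ) ^ n * x) * k x) μ :=
    fun k hk => hk.bdd_mul (by fun_prop : Measurable _).aestronglyMeasurable (Eventually.of_forall fun x => hF1 _)
  have h2 : |(∫ x, F ((R : ℝ) ^ n * x) * g x ∂μ) - ∫ x, F ((R : ℝ) ^ n * x) * h x ∂μ| ≤ ε / 4 := by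
    rw [← integral_sub (hbm g hg) (hbm h hhi)]
    refine abs_integral_le_integral_abs.trans (le_trans ?_ hgh)
    refine integral_mono ((hbm g hg).sub (hbm h hhi)).abs (hg.sub hhi).abs fun x => ?_
    simp only [← mul_sub, abs_mul]
    exact mul_le_of_le_one_left (abs_nonneg _) (hF1 _)
  have h3 : |(∫ x, F x ∂μ) * (∫ x, h x ∂μ) - (∫ x, F x ∂μ) * ∫ x, g x ∂μ| ≤ ε / 4 := by
    rw [← mul_sub, abs_mul, abs_sub_comm, ← integral_sub hg hhi]
    exact (mul_le_of_le_one_left (abs_nonneg _) hF1').trans (abs_integral_le_integral_abs.trans hgh)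
  have := abs_sub_le (∫ x, F ((R : ℝ) ^ n * x) * g x ∂μ) (∫ x, F ((R : ℝ) ^ n * x) * h x ∂μ)
    ((∫ x, F x ∂μ) * ∫ x, g x ∂μ)
  have := abs_sub_le (∫ x, F ((R : ℝ) ^ n * x) * h x ∂μ) ((∫ x, F x ∂μ) * ∫ x, h x ∂μ)
    ((∫ x, F x ∂μ) * ∫ x, g x ∂μ)
  linarith

/-- Open neighbourhoods of `0` have positive measure, if `0 ∈ B`. -/
theorem IsInvariantMeasure.pos_of_isOpen (hR : 1 < R) (hμ : IsInvariantMeasure R B μ)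
    (hB : (0 : ℤ) ∈ B) {U : Set ℝ} (hU : IsOpen U) (h0 : (0 : ℝ) ∈ U) : μ U ≠ 0 := by
  intro hU0
  have hR1 : (1 : ℝ) < R := by exact_mod_cast hR
  -- Preimages of null sets under `τ_0(x) = x / R` are null, and the iterated preimages of a
  -- neighbourhood of `0` exhaust `ℝ`.
  have hnull : ∀ n : ℕ, μ {x | ((R : ℝ)⁻¹) ^ n * x ∈ U} = 0 := by
    intro n
    induction n with
    | zero => simpa using hU0
    | succ n ih =>
      have hm : MeasurableSet {x : ℝ | ((R : ℝ)⁻¹) ^ n * x ∈ U} :=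
        (hU.preimage (by fun_prop : Continuous fun x : ℝ => ((R : ℝ)⁻¹) ^ n * x)).measurableSet
      have := hμ.null_preimage hm ih hB
      simpa [contr, pow_succ, mul_assoc] using this
  have huniv : (Set.univ : Set ℝ) ⊆ ⋃ n : ℕ, {x | ((R : ℝ)⁻¹) ^ n * x ∈ U} := by
    intro x _
    have ht : Tendsto (fun n : ℕ => ((R : ℝ)⁻¹) ^ n * x) atTop (𝓝 0) := by
      simpa using (tendsto_pow_atTop_nhds_zero_of_lt_one (by positivity)
        (inv_lt_one_of_one_lt₀ hR1)).mul_const x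
    obtain ⟨n, hn⟩ := (ht.eventually (hU.mem_nhds h0)).exists
    exact Set.mem_iUnion.2 ⟨n, hn⟩
  have := measure_mono_null huniv (measure_iUnion_null hnull)
  simp at this

/-- The atoms of maximal mass would form a finite non-empty set `M`. The mass at `y` is the average
of the masses at `R y - c`, so maximality puts all of these into `M`. Hence `M` is stable under
translation by `-b`, which is impossible for `b ≠ 0`. -/
theorem IsInvariantMeasure.measure_singleton_eq_zero (hR : 1 < R) (hμ : IsInvariantMeasure R B μ)
    (hB0 : (0 : ℤ) ∈ B) {b : ℤ} (hb : b ∈ B) (hb0 : b ≠ 0) (x : ℝ) : μ {x} = 0 := by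
  by_contra hx
  have hR0 : (R : ℝ) ≠ 0 := by exact_mod_cast (by omega : R ≠ 0)
  have hfin : ∀ c : ENNReal, c ≠ 0 → {y : ℝ | c ≤ μ {y}}.Finite := fun c hc =>
    Measure.finite_const_le_meas_of_disjoint_iUnion μ (pos_iff_ne_zero.2 hc)
      (fun y => measurableSet_singleton y)
      (fun y z hyz => Set.disjoint_singleton.2 hyz) (measure_ne_top _ _)
  obtain ⟨x₁, hx₁, hmax⟩ := Set.exists_max_image _ (fun y : ℝ => μ {y}) (hfin _ hx) ⟨x, le_refl (μ {x})⟩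
  have hmax' : ∀ y, μ {y} ≤ μ {x₁} := fun y => by
    by_cases hy : μ {x} ≤ μ {y}
    · exact hmax y hy
    · exact (not_le.1 hy).le.trans hx₁
  have hne : μ {x₁} ≠ 0 := fun h => hx (le_zero_iff.1 (h ▸ hx₁))
  set M : Set ℝ := {y | μ {x₁} ≤ μ {y}} with hM
  have hMfin : M.Finite := hfin _ hne
  have hstep : ∀ y ∈ M, ∀ c ∈ B, (R : ℝ) * y - c ∈ M := by
    intro y hy c hc
    have hpre : ∀ c : ℤ, contr R c ⁻¹' {y} = {(R : ℝ) * y - c} := fun c => by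
      ext z
      simp only [contr, Set.mem_preimage, Set.mem_singleton_iff]
      rw [inv_mul_eq_iff_eq_mul₀ hR0, eq_sub_iff_add_eq]
    have hinv := congrArg ENNReal.toReal (hμ {y} (measurableSet_singleton y))
    simp only [hpre] at hinv
    rw [ENNReal.toReal_mul, ENNReal.toReal_inv, ENNReal.toReal_natCast,
      ENNReal.toReal_sum fun _ _ => measure_ne_top _ _] at hinv
    by_contra hlt
    have hlt' : μ {(R : ℝ) * y - c} < μ {x₁} := not_le.1 hlt
    have hsum : ∑ c ∈ B, (μ {(R : ℝ) * y - (c : ℤ)}).toReal < ∑ _c ∈ B, (μ {x₁}).toReal :=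
      Finset.sum_lt_sum (fun _ _ => ENNReal.toReal_mono (measure_ne_top _ _) (hmax' _))
        ⟨c, hc, (ENNReal.toReal_lt_toReal (measure_ne_top _ _) (measure_ne_top _ _)).2 hlt'⟩
    have hcard : 0 < (B.card : ℝ)⁻¹ := by
      have := Finset.card_pos.2 ⟨0, hB0⟩
      positivity
    have hlt2 := mul_lt_mul_of_pos_left hsum hcard
    rw [← hinv, card_inv_mul_sum_const ⟨0, hB0⟩] at hlt2
    exact not_le.2 hlt2 (ENNReal.toReal_mono (measure_ne_top _ _) hy)
  -- As `0 ∈ B`, multiplication by `R` is an injective self-map of the finite set `M`, hence onto;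
  -- so `R y - b ∈ M` reads `z - b ∈ M` for every `z ∈ M`.
  have hsurj : Set.SurjOn (fun y : ℝ => (R : ℝ) * y) M M := by
    refine ((hMfin.injOn_iff_bijOn_of_mapsTo fun y hy => ?_).1 fun y _ z _ hyz =>
      mul_left_cancel₀ hR0 hyz).surjOn
    simpa using hstep y hy 0 hB0
  have hsub : ∀ y ∈ M, y - b ∈ M := by
    intro y hy
    obtain ⟨z, hz, rfl⟩ := hsurj hy
    exact hstep z hz b hb
  have hk : ∀ k : ℕ, x₁ - k * b ∈ M := by
    intro k
    induction k with
    | zero => simp [hM]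
    | succ k ih =>
      have := hsub _ ih
      rw [sub_sub] at this
      rwa [Nat.cast_succ, add_mul, one_mul]
  refine Set.infinite_of_injective_forall_mem (f := fun k : ℕ => x₁ - k * (b : ℝ)) ?_ hk hMfin
  intro k j hkj
  have hb' : (b : ℝ) ≠ 0 := by exact_mod_cast hb0
  have : (k : ℝ) * b = j * b := by simpa using hkj
  exact_mod_cast mul_right_cancel₀ hb' this

end Invariant

/-! ### Characters and masks. -/

theorem expo_add (s t x : ℝ) : expo (s + t) x = expo s x * expo t x := by
  rw [expo, expo, expo, ← Complex.exp_add]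
  congr 1; push_cast; ring

theorem expo_add_right (t x y : ℝ) : expo t (x + y) = expo t x * expo t y := by
  rw [expo, expo, expo, ← Complex.exp_add]
  congr 1; push_cast; ring

theorem expo_eq_one {t x : ℝ} {k : ℤ} (h : t * x = k) : expo t x = 1 := by
  rw [expo, h, Complex.exp_eq_one_iff]
  exact ⟨k, by push_cast; ring⟩

theorem expo_zero_right (t : ℝ) : expo t 0 = 1 := by simp [expo]

theorem expo_neg (t x : ℝ) : expo (-t) x = (starRingEnd ℂ) (expo t x) := by
  rw [expo, expo, ← Complex.exp_conj]
  congr 1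
  simp only [map_mul, Complex.conj_ofReal, Complex.conj_I, map_ofNat]
  push_cast; ring

theorem continuous_expo (t : ℝ) : Continuous (expo t) := by
  unfold expo; fun_prop

theorem analyticAt_expo (t x : ℝ) : AnalyticAt ℝ (expo t) x := by
  unfold expo
  have h1 : AnalyticAt ℝ (fun x : ℝ => 2 * (Real.pi : ℂ) * Complex.I * ((t * x : ℝ) : ℂ)) x := by
    have h2 : AnalyticAt ℝ (fun x : ℝ => ((t * x : ℝ) : ℂ)) x :=
      (Complex.ofRealCLM.analyticAt _).comp (analyticAt_const.mul analyticAt_id)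
    exact analyticAt_const.mul h2
  exact (analyticAt_cexp.restrictScalars (𝕜 := ℝ)).comp h1

theorem continuous_mask (S : Finset ℤ) : Continuous (mask S) := by
  unfold mask
  exact continuous_const.mul (continuous_finsetSum _ fun s _ => continuous_expo s)

theorem mask_zero {S : Finset ℤ} (hS : S.Nonempty) : mask S 0 = 1 := by
  have : (S.card : ℂ) ≠ 0 := by exact_mod_cast hS.card_ne_zero
  simp [mask, expo_zero_right, this]

theorem mask_periodic (S : Finset ℤ) (k : ℤ) : Function.Periodic (mask S) (k : ℝ) := by
  intro x
  unfold mask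
  congr 1
  refine Finset.sum_congr rfl fun s _ => ?_
  rw [expo_add_right, expo_eq_one (t := s) (x := k) (k := s * k) (by push_cast; rfl), mul_one]

/-- A non-trivial trigonometric polynomial vanishes only on a null set of an atomless measure. -/
theorem ae_mask_ne_zero {S : Finset ℤ} (hS : S.Nonempty) {μ : Measure ℝ}
    (hμ : ∀ x, μ {x} = 0) : ∀ᵐ x ∂μ, mask S x ≠ 0 := by
  have : NullSingletonClass μ := ⟨hμ⟩
  have han : AnalyticOnNhd ℝ (mask S) Set.univ := fun x _ => by
    unfold mask
    exact analyticAt_const.mul (Finset.analyticAt_fun_sum _ fun s _ => analyticAt_expo s x)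
  -- The mask is real analytic and equals `1` at `0`, so its zeros are isolated.
  have h := han.preimage_zero_mem_codiscrete (x := 0) (by rw [mask_zero hS]; exact one_ne_zero)
  have h2 := ae_restrict_le_codiscreteWithin (μ := μ) MeasurableSet.univ h
  rwa [Measure.restrict_univ] at h2

/-! ### Frequencies and the product formula. -/

section Frequencies

variable {R : ℕ} {B L : Finset ℤ}

/-- Elements of `L` are distinguished by the characters `b / R`, `b ∈ B`. -/
theorem IsHadamardPair.eq_of_forall_int (h : IsHadamardPair R B L) {l l' : ℤ} (hl : l ∈ L)
    (hl' : l' ∈ L) (H : ∀ b ∈ B, ∃ k : ℤ, (R : ℝ)⁻¹ * b * (l' - l) = k) : l = l' := by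
  by_contra hne
  have hcol : ∀ b : B, hadamardMatrix R B L b ⟨l', hl'⟩ = hadamardMatrix R B L b ⟨l, hl⟩ := by
    intro b
    obtain ⟨k, hk⟩ := H b b.2
    simp only [hadamardMatrix, Matrix.of_apply]
    have : ((l' : ℤ) : ℝ) = l + (l' - l) := by ring
    rw [this, expo_add_right, expo_eq_one hk, mul_one]
  have h1 := congrFun (congrFun h.conjTranspose_mul ⟨l, hl⟩) ⟨l', hl'⟩
  have h2 := congrFun (congrFun h.conjTranspose_mul ⟨l, hl⟩) ⟨l, hl⟩
  rw [Matrix.mul_apply] at h1 h2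
  simp only [hcol] at h1
  rw [h1, Matrix.one_apply_eq, Matrix.one_apply_ne (by simpa using hne)] at h2
  exact zero_ne_one h2

/-- Integrality starts from `|m_B| = 1` on extreme cycles and survives `t ↦ R t + l`. It yields both
the periodicity of `D_n` and the unique representation of frequencies. -/
theorem freq_mul_mem_int (h0 : (0 : ℤ) ∈ B) {b : ℤ} (hb : b ∈ B) (n : ℕ) {t : ℝ}
    (ht : t ∈ freq R B L n) : ∃ k : ℤ, t * b = k := by
  induction n generalizing t with
  | zero =>
    obtain ⟨C, hC, htC⟩ := ht
    obtain ⟨k, hk⟩ := mul_mem_int h0 hb (hC.2 _ htC)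
    exact ⟨-k, by push_cast; rw [← hk]; ring⟩
  | succ n ih =>
    obtain ⟨s, hs, l, -, rfl⟩ := ht
    obtain ⟨k, hk⟩ := ih hs
    exact ⟨R * k + l * b, by push_cast; rw [← hk]; ring⟩

theorem zero_mem_freq_zero (h : IsHadamardPair R B L) : (0 : ℝ) ∈ freq R B L 0 := by
  refine ⟨{0}, ⟨⟨1, fun _ => 0, fun _ => 0, one_pos, ?_, rfl, fun i _ => ⟨h.zero_mem_right, ?_⟩⟩,
    ?_⟩, by simp⟩
  · ext y
    simp only [Set.mem_singleton_iff, Set.mem_image, Set.mem_Iio]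
    exact ⟨fun hy => ⟨0, one_pos, hy.symm⟩, fun ⟨_, _, hy⟩ => hy.symm⟩
  · simp [contr]
  · rintro y rfl
    rw [mask_zero ⟨0, h.zero_mem_left⟩, norm_one]

theorem dirichlet_eq_sum {n : ℕ} (hf : (freq R B L n).Finite) (x : ℝ) :
    dirichlet R B L n x = ∑ t ∈ hf.toFinset, expo t x :=
  finsum_mem_eq_finite_toFinset_sum _ hf

theorem continuous_dirichlet (hR : 1 < R) (h : IsHadamardPair R B L) (n : ℕ) :
    Continuous (dirichlet R B L n) := by
  have : dirichlet R B L n = fun x => ∑ t ∈ (freq_finite hR h n).toFinset, expo t x :=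
    funext fun x => dirichlet_eq_sum (freq_finite hR h n) x
  rw [this]
  exact continuous_finsetSum _ fun t _ => continuous_expo t

theorem dirichlet_periodic (hR : 1 < R) (h : IsHadamardPair R B L) (n : ℕ) {b : ℤ} (hb : b ∈ B) :
    Function.Periodic (dirichlet R B L n) (b : ℝ) := by
  intro x
  simp only [dirichlet_eq_sum (freq_finite hR h n)]
  refine Finset.sum_congr rfl fun t ht => ?_
  obtain ⟨k, hk⟩ := freq_mul_mem_int h.zero_mem_left hb n ((freq_finite hR h n).mem_toFinset.1 ht)
  rw [expo_add_right, expo_eq_one hk, mul_one]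

theorem dirichlet_succ (hR : 1 < R) (h : IsHadamardPair R B L) (n : ℕ) (x : ℝ) :
    dirichlet R B L (n + 1) x
      = (B.card : ℂ) * mask L x * dirichlet R B L n (R * x) := by
  classical
  have hR0 : (R : ℝ) ≠ 0 := by exact_mod_cast (by omega : R ≠ 0)
  have hL : (L.card : ℂ) ≠ 0 := by
    exact_mod_cast (Finset.card_pos.2 ⟨0, h.zero_mem_right⟩).ne'
  rw [dirichlet_eq_sum (freq_finite hR h n), dirichlet_eq_sum (freq_finite hR h (n + 1)), h.card_eq,
    mask, mul_inv_cancel_left₀ hL, mul_comm, Finset.sum_mul_sum, ← Finset.sum_product']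
  have himg : (freq_finite hR h (n + 1)).toFinset
      = ((freq_finite hR h n).toFinset ×ˢ L).image
        fun q : ℝ × ℤ => (R : ℝ) * q.1 + (q.2 : ℝ) := by
    ext y
    simp only [Set.Finite.mem_toFinset, Finset.mem_image, Finset.mem_product, Prod.exists]
    constructor
    · rintro ⟨t, ht, l, hl, rfl⟩
      exact ⟨t, l, ⟨ht, hl⟩, rfl⟩
    · rintro ⟨t, l, ⟨ht, hl⟩, rfl⟩
      exact ⟨t, ht, l, hl, rfl⟩
  rw [himg, Finset.sum_image]
  · refine Finset.sum_congr rfl fun q _ => ?_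
    rw [expo_add]
    congr 1
    unfold expo
    congr 3
    ring
  -- No frequency is produced twice: if `R t + l = R t' + l'`, then `b (l' - l) / R = b (t - t')` is
  -- an integer for all `b ∈ B`, and the Hadamard property forces `l = l'`.
  · rintro ⟨t, l⟩ hq ⟨t', l'⟩ hq' heq
    simp only [Finset.coe_product, Set.mem_prod, Set.Finite.coe_toFinset, Finset.mem_coe]
      at hq hq' heq
    have hll : l = l' := by
      refine h.eq_of_forall_int hq.2 hq'.2 fun b hb => ?_
      obtain ⟨k, hk⟩ := freq_mul_mem_int h.zero_mem_left hb n hq.1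
      obtain ⟨k', hk'⟩ := freq_mul_mem_int h.zero_mem_left hb n hq'.1
      refine ⟨k - k', ?_⟩
      have : (l' : ℝ) - l = R * (t - t') := by linarith
      rw [this]
      push_cast
      rw [← hk, ← hk']
      field_simp
    subst hll
    have : t = t' := mul_left_cancel₀ hR0 (by linarith)
    rw [this]

/-- The kernel `D_n` is a Riesz type product. -/
theorem dirichlet_eq_prod (hR : 1 < R) (h : IsHadamardPair R B L) (n : ℕ) (x : ℝ) :
    dirichlet R B L n x = (∏ k ∈ Finset.range n, (B.card : ℂ) * mask L ((R : ℝ) ^ k * x))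
      * dirichlet R B L 0 ((R : ℝ) ^ n * x) := by
  induction n generalizing x with
  | zero => simp
  | succ n ih =>
    rw [dirichlet_succ hR h, ih, Finset.prod_range_succ']
    simp only [pow_succ, pow_zero, one_mul, mul_assoc]
    ring

theorem one_le_norm_dirichlet_zero (hR : 1 < R) (h : IsHadamardPair R B L) :
    1 ≤ ‖dirichlet R B L 0 0‖ := by
  rw [dirichlet_eq_sum (freq_finite hR h 0)]
  simp only [expo_zero_right, Finset.sum_const, nsmul_eq_mul, mul_one, Complex.norm_natCast]
  exact_mod_cast Finset.card_pos.2 ⟨0, (freq_finite hR h 0).mem_toFinset.2 (zero_mem_freq_zero h)⟩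

theorem partialSum_zero (hR : 1 < R) (h : IsHadamardPair R B L) {μ : Measure ℝ} (n : ℕ)
    {f : ℝ → ℂ} (hf : Integrable f μ) :
    partialSum R B L μ n f 0 = ∫ y, f y * (starRingEnd ℂ) (dirichlet R B L n y) ∂μ := by
  rw [partialSum, finsum_mem_eq_finite_toFinset_sum _ (freq_finite hR h n)]
  simp only [expo_zero_right, mul_one, dirichlet_eq_sum (freq_finite hR h n), map_sum,
    Finset.mul_sum, ← expo_neg]
  rw [integral_finsetSum]
  exact fun t _ => hf.mul_bdd (c := 1) (continuous_expo _).aestronglyMeasurable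
    (Eventually.of_forall fun y => (norm_expo _ _).le)

/-- For `B = {0}` one has `|N m_L| = 1` everywhere, so the geometric mean is exactly `1`. The
non-zero digit is what excludes atoms. -/
theorem IsHadamardPair.exists_ne_zero (h : IsHadamardPair R B L) {μ : Measure ℝ}
    (hΔ : 1 < geomMean μ (fun x => (B.card : ℂ) * mask L x)) : ∃ b ∈ B, b ≠ 0 := by
  by_contra! hB
  have hB1 : B = {0} := Finset.eq_singleton_iff_unique_mem.2 ⟨h.zero_mem_left, hB⟩
  have hcard : L.card = 1 := by rw [← h.card_eq, hB1]; simp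
  obtain ⟨a, ha⟩ := Finset.card_eq_one.1 hcard
  refine lt_irrefl (1 : ℝ) (hΔ.trans_eq ?_)
  simp [geomMean, mask, ha, hB1, norm_expo]

end Frequencies

/-! ### Exponential growth of the Lebesgue constants. -/

section Growth

/-- The integral of a non-integrable function is `0` by convention, which would make the geometric
mean `1`. -/
theorem integrable_log_of_one_lt_geomMean {μ : Measure ℝ} {g : ℝ → ℂ} (hΔ : 1 < geomMean μ g) :
    Integrable (fun x => Real.log ‖g x‖) μ := by
  by_contra hni
  rw [geomMean, integral_undef hni, Real.exp_zero] at hΔ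
  exact lt_irrefl _ hΔ

variable {R : ℕ} {B L : Finset ℤ} {μ : Measure ℝ} [IsProbabilityMeasure μ]

theorem integrable_dirichlet (hR : 1 < R) (h : IsHadamardPair R B L) (n : ℕ) :
    Integrable (dirichlet R B L n) μ := by
  refine Integrable.of_bound (continuous_dirichlet hR h n).aestronglyMeasurable
    ((freq_finite hR h n).toFinset.card) (Eventually.of_forall fun x => ?_)
  rw [dirichlet_eq_sum (freq_finite hR h n)]
  refine (norm_sum_le _ _).trans ?_
  simp [norm_expo]

/-- Exponential growth of the Lebesgue constants. -/
theorem exists_mul_pow_le_integral_dirichlet (hR : 1 < R) (h : IsHadamardPair R B L)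
    (hμ : IsInvariantMeasure R B μ)
    (hΔ : 1 < geomMean μ (fun x => (B.card : ℂ) * mask L x)) {ρ : ℝ} (hρ1 : 1 < ρ)
    (hρ : ρ < geomMean μ (fun x => (B.card : ℂ) * mask L x)) :
    ∃ C : ℝ, 0 < C ∧ ∀ᶠ n : ℕ in atTop, C * ρ ^ n ≤ ∫ x, ‖dirichlet R B L n x‖ ∂μ := by
  have hB : B.Nonempty := ⟨0, h.zero_mem_left⟩
  have hBc : (B.card : ℂ) ≠ 0 := by exact_mod_cast hB.card_ne_zero
  obtain ⟨b, hb, hb0⟩ := h.exists_ne_zero hΔ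
  set G : ℝ → ℂ := fun x => (B.card : ℂ) * mask L x with hG
  set g : ℝ → ℝ := fun x => Real.log ‖G x‖ with hg
  have hGc : Continuous G := continuous_const.mul (continuous_mask L)
  have hgi : Integrable g μ := integrable_log_of_one_lt_geomMean hΔ
  have hgm : Measurable g := Real.measurable_log.comp hGc.norm.measurable
  have hGp : ∀ c : ℤ, Function.Periodic G (c : ℝ) := fun c x => by
    simp only [hG, mask_periodic L c x]
  have hgp : ∀ c ∈ B, Function.Periodic g (c : ℝ) := fun c _ x => by
    simp only [hg, hGp c x]
  -- The zero set is null, and its indicator is periodic, so its pullbacks under `x ↦ R^k x` are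
  -- null too. This matters because `Real.log 0 = 0` would falsify the logarithm of the product.
  have hG0 : ∀ᵐ x ∂μ, ∀ k : ℕ, G ((R : ℝ) ^ k * x) ≠ 0 := by
    have hnull := fun x => hμ.measure_singleton_eq_zero hR h.zero_mem_left hb hb0 x
    rw [ae_all_iff]
    intro k
    have h0 : ∀ᵐ x ∂μ, G x ≠ 0 := by
      filter_upwards [ae_mask_ne_zero ⟨0, h.zero_mem_right⟩ hnull] with x hx
      exact mul_ne_zero hBc hx
    set F : ℝ → ℝ := {x | G x = 0}.indicator 1 with hF
    have hZ : MeasurableSet {x | G x = 0} := measurableSet_eq_fun hGc.measurable measurable_const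
    have hFm : Measurable F := measurable_one.indicator hZ
    have hFp : ∀ c ∈ B, Function.Periodic F (c : ℝ) := fun c _ x => by
      simp only [hF, Set.indicator_apply, Set.mem_ofPred_eq, hGp c x, Pi.one_apply]
    have hF0 : F =ᵐ[μ] 0 := by
      filter_upwards [h0] with x hx
      simp [hF, hx]
    have hFk := hμ.integrable_and_integral_comp_pow_mul hR hB hFp hFm ((integrable_zero _ _ _).congr hF0.symm) k
    rw [integral_congr_ae hF0] at hFk
    have hFk0 := (integral_eq_zero_iff_of_nonneg (f := fun x => F ((R : ℝ) ^ k * x))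
      (fun x => Set.indicator_nonneg (fun _ _ => zero_le_one) _) hFk.1).1 (hFk.2.trans (by simp))
    filter_upwards [hFk0] with x hx hGx
    simp [hF, hGx] at hx
  set U : Set ℝ := {x | 1 / 2 < ‖dirichlet R B L 0 x‖} with hU
  have hUo : IsOpen U := isOpen_lt continuous_const (continuous_dirichlet hR h 0).norm
  have hU0 : (0 : ℝ) ∈ U := lt_of_lt_of_le (by norm_num) (one_le_norm_dirichlet_zero hR h)
  set F : ℝ → ℝ := U.indicator 1 with hF
  have hFm : Measurable F := measurable_one.indicator hUo.measurableSet
  have hFnn : ∀ x, 0 ≤ F x := fun x => Set.indicator_nonneg (fun _ _ => zero_le_one) _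
  have hF1 : ∀ x, ‖F x‖ ≤ 1 := fun x => by
    by_cases hx : x ∈ U <;> simp [hF, hx]
  have hFp : ∀ c ∈ B, Function.Periodic F (c : ℝ) := fun c hc x => by
    simp only [hF, hU, Set.indicator_apply, Set.mem_ofPred_eq, dirichlet_periodic hR h 0 hc x,
      Pi.one_apply]
  have hFi : Integrable F μ := Integrable.of_bound hFm.aestronglyMeasurable 1
    (Eventually.of_forall hF1)
  have hFle : ∀ x, F x ≤ 2 * ‖dirichlet R B L 0 x‖ := fun x => by
    by_cases hx : x ∈ U
    · have : 1 / 2 < ‖dirichlet R B L 0 x‖ := hx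
      simp only [hF, Set.indicator_of_mem hx, Pi.one_apply]
      linarith
    · simp only [hF, Set.indicator_of_notMem hx]
      positivity
  set m : ℝ := ∫ x, F x ∂μ with hm
  have hmpos : 0 < m := by
    rw [hm, hF, integral_indicator_one hUo.measurableSet]
    exact ENNReal.toReal_pos (hμ.pos_of_isOpen hR h.zero_mem_left hUo hU0) (measure_ne_top _ _)
  set I : ℝ := ∫ x, g x ∂μ with hI
  have hρI : Real.log ρ < I := by
    rw [← Real.log_exp I]
    exact Real.log_lt_log (by linarith) hρ
  have hmix := hμ.tendsto_integral_comp_pow_mul hR hB hFp hFm hF1 hgi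
  -- The shift by one is needed because the exponents `n - k`, for `k < n`, run through `1, …, n`.
  have hces := (hmix.comp (tendsto_add_atTop_nat 1)).cesaro
  have hlt : m * Real.log ρ < m * I := mul_lt_mul_of_pos_left hρI hmpos
  -- Here `m = μ(U)`, and the `2` comes from `F ≤ 2 |D_0|`.
  refine ⟨m / 2, by positivity, ?_⟩
  filter_upwards [hces.eventually (lt_mem_nhds hlt), eventually_gt_atTop 0] with n hn hn0
  have hn0' : (0 : ℝ) < n := by exact_mod_cast hn0
  have hterm : ∀ k ∈ Finset.range n,
      Integrable (fun x => F ((R : ℝ) ^ n * x) * g ((R : ℝ) ^ k * x)) μ ∧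
        ∫ x, F ((R : ℝ) ^ n * x) * g ((R : ℝ) ^ k * x) ∂μ
          = ∫ x, F ((R : ℝ) ^ (n - 1 - k + 1) * x) * g x ∂μ := by
    intro k hk
    have hkn : n = n - 1 - k + 1 + k := by have := Finset.mem_range.1 hk; omega
    have := hμ.integrable_and_integral_comp_pow_mul hR hB
      (F := fun x => F ((R : ℝ) ^ (n - 1 - k + 1) * x) * g x)
      (fun c hc x => by
        have := periodic_comp_pow_mul (R := R) (hFp c hc) (n - 1 - k + 1) x
        simp only at this ⊢
        rw [this, hgp c hc x]) (by fun_prop)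
      (hgi.bdd_mul (by fun_prop : Measurable _).aestronglyMeasurable
        (Eventually.of_forall fun x => hF1 _)) k
    simp only [← mul_assoc, ← pow_add, ← hkn] at this
    exact this
  have hsum : Integrable (fun x => F ((R : ℝ) ^ n * x) *
      ∑ k ∈ Finset.range n, g ((R : ℝ) ^ k * x)) μ ∧
      n * (m * Real.log ρ) ≤ ∫ x, F ((R : ℝ) ^ n * x) *
        ∑ k ∈ Finset.range n, g ((R : ℝ) ^ k * x) ∂μ := by
    simp only [Finset.mul_sum]
    refine ⟨integrable_finsetSum _ fun k hk => (hterm k hk).1, ?_⟩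
    rw [integral_finsetSum _ fun k hk => (hterm k hk).1,
      Finset.sum_congr rfl fun k hk => (hterm k hk).2,
      Finset.sum_range_reflect (fun j => ∫ x, F ((R : ℝ) ^ (j + 1) * x) * g x ∂μ)]
    have := mul_lt_mul_of_pos_left hn hn0'
    rw [mul_inv_cancel_left₀ hn0'.ne'] at this
    exact this.le
  have hFn := hμ.integrable_and_integral_comp_pow_mul hR hB hFp hFm hFi n
  have hρn : 0 < ρ ^ n := by positivity
  have hpt : ∀ᵐ x ∂μ, ρ ^ n * (F ((R : ℝ) ^ n * x) + (F ((R : ℝ) ^ n * x) *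
      ∑ k ∈ Finset.range n, g ((R : ℝ) ^ k * x) - n * Real.log ρ * F ((R : ℝ) ^ n * x)))
      ≤ 2 * ‖dirichlet R B L n x‖ := by
    filter_upwards [hG0] with x hx
    set P : ℝ := ‖∏ k ∈ Finset.range n, G ((R : ℝ) ^ k * x)‖ with hP
    have hPpos : 0 < P := norm_pos_iff.2 (Finset.prod_ne_zero_iff.2 fun k _ => hx k)
    have hlog : ∑ k ∈ Finset.range n, g ((R : ℝ) ^ k * x) = Real.log P := by
      rw [hP, norm_prod, Real.log_prod fun k _ => norm_ne_zero_iff.2 (hx k)]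
    -- The tangent line bound `1 + t ≤ exp t` at `t = log P - n log ρ` stands in for Jensen's
    -- inequality. After multiplication by `F(R^n x)` and integration, the part linear in `t` is
    -- non-negative by `hsum`, leaving `ρ^n m`.
    have hle : ρ ^ n * (1 + (Real.log P - n * Real.log ρ)) ≤ P := by
      have h1 := Real.add_one_le_exp (Real.log P - n * Real.log ρ)
      rw [Real.exp_sub, Real.exp_log hPpos, ← Real.log_pow, Real.exp_log hρn,
        le_div_iff₀ hρn, Real.log_pow] at h1
      linarith
    rw [hlog, dirichlet_eq_prod hR h, norm_mul]
    have h1 := mul_le_mul_of_nonneg_right hle (hFnn ((R : ℝ) ^ n * x))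
    have h2 := mul_le_mul_of_nonneg_left (hFle ((R : ℝ) ^ n * x)) hPpos.le
    calc _ = ρ ^ n * (1 + (Real.log P - n * Real.log ρ)) * F ((R : ℝ) ^ n * x) := by ring
      _ ≤ P * (2 * ‖dirichlet R B L 0 ((R : ℝ) ^ n * x)‖) := h1.trans h2
      _ = 2 * (P * ‖dirichlet R B L 0 ((R : ℝ) ^ n * x)‖) := by ring
  have hDi : Integrable (fun x => ‖dirichlet R B L n x‖) μ := (integrable_dirichlet hR h n).norm
  have hfin := integral_mono_ae
    ((hFn.1.add (hsum.1.sub (hFn.1.const_mul (n * Real.log ρ)))).const_mul (ρ ^ n))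
    (hDi.const_mul 2) hpt
  simp only [Pi.add_apply, Pi.sub_apply] at hfin
  have hsplit : ∫ x, (F ((R : ℝ) ^ n * x) + (F ((R : ℝ) ^ n * x) *
      ∑ k ∈ Finset.range n, g ((R : ℝ) ^ k * x) - n * Real.log ρ * F ((R : ℝ) ^ n * x))) ∂μ
      = m + ((∫ x, F ((R : ℝ) ^ n * x) * ∑ k ∈ Finset.range n, g ((R : ℝ) ^ k * x) ∂μ)
        - n * Real.log ρ * m) := by
    rw [integral_add hFn.1, integral_sub hsum.1 (hFn.1.const_mul _), integral_const_mul, hFn.2]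
    exact hsum.1.sub (hFn.1.const_mul _)
  rw [integral_const_mul, integral_const_mul, hsplit] at hfin
  have h3 : ρ ^ n * m ≤ 2 * ∫ x, ‖dirichlet R B L n x‖ ∂μ := by
    refine le_trans (mul_le_mul_of_nonneg_left ?_ hρn.le) hfin
    have := hsum.2
    linarith
  linarith

end Growth

/-! ### Unbounded functionals and divergence at zero. -/

section Divergence

variable {μ : Measure ℝ} [IsProbabilityMeasure μ]

/-- The functional `f ↦ ∫ f \bar D dμ` on bounded continuous functions. -/
noncomputable def kernelFunctional (μ : Measure ℝ) [IsProbabilityMeasure μ] {D : ℝ → ℂ}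
    (hD : Integrable D μ) : BoundedContinuousFunction ℝ ℂ →L[ℂ] ℂ :=
  LinearMap.mkContinuous
    { toFun := fun f => ∫ y, f y * (starRingEnd ℂ) (D y) ∂μ
      map_add' := fun f g => by
        have hi : ∀ f : BoundedContinuousFunction ℝ ℂ,
            Integrable (fun y => f y * (starRingEnd ℂ) (D y)) μ := fun f =>
          ((LinearIsometryEquiv.integrable_comp_iff Complex.conjLIE).2 hD).bdd_mul
            f.continuous.aestronglyMeasurable (Eventually.of_forall f.norm_coe_le_norm)
        simp only [BoundedContinuousFunction.coe_add, Pi.add_apply, add_mul]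
        exact integral_add (hi f) (hi g)
      map_smul' := fun c f => by
        simp only [BoundedContinuousFunction.coe_smul, smul_eq_mul, mul_assoc, RingHom.id_apply]
        exact integral_const_mul _ _ }
    (∫ y, ‖D y‖ ∂μ) fun f => by
      refine (norm_integral_le_of_norm_le (hD.norm.mul_const ‖f‖)
        (Eventually.of_forall fun y => ?_)).trans_eq (integral_mul_const _ _)
      rw [norm_mul, RCLike.norm_conj, mul_comm]
      exact mul_le_mul_of_nonneg_left (f.norm_coe_le_norm y) (norm_nonneg _)

theorem kernelFunctional_apply {D : ℝ → ℂ} (hD : Integrable D μ)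
    (f : BoundedContinuousFunction ℝ ℂ) :
    kernelFunctional μ hD f = ∫ y, f y * (starRingEnd ℂ) (D y) ∂μ := rfl

/-- The phase `D / |D|` may be discontinuous at zeros of `D`; the test function `D / (|D| + 1)` is
continuous, and `|D|² / (|D| + 1) ≥ |D| - 1` bounds the loss by `1`. -/
theorem integral_norm_sub_one_le_norm_kernelFunctional {D : ℝ → ℂ} (hDc : Continuous D)
    (hD : Integrable D μ) : (∫ y, ‖D y‖ ∂μ) - 1 ≤ ‖kernelFunctional μ hD‖ := by
  have hpos : ∀ y, 0 < ‖D y‖ + 1 := fun y => by positivity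
  have hne : ∀ y, ((‖D y‖ + 1 : ℝ) : ℂ) ≠ 0 := fun y => by exact_mod_cast (hpos y).ne'
  have hbd : ∀ y, ‖D y / ((‖D y‖ + 1 : ℝ) : ℂ)‖ ≤ 1 := fun y => by
    rw [norm_div, Complex.norm_real, Real.norm_of_nonneg (hpos y).le, div_le_one (hpos y)]
    linarith
  let f : BoundedContinuousFunction ℝ ℂ := BoundedContinuousFunction.ofNormedAddCommGroup
    (fun y => D y / ((‖D y‖ + 1 : ℝ) : ℂ))
    (hDc.div (Complex.continuous_ofReal.comp (hDc.norm.add continuous_const)) hne) 1 hbd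
  have hf : ‖f‖ ≤ 1 := BoundedContinuousFunction.norm_ofNormedAddCommGroup_le _ zero_le_one hbd
  have hval : ∀ y, f y * (starRingEnd ℂ) (D y) = ((‖D y‖ ^ 2 / (‖D y‖ + 1) : ℝ) : ℂ) := fun y => by
    change D y / ((‖D y‖ + 1 : ℝ) : ℂ) * (starRingEnd ℂ) (D y) = _
    rw [div_mul_eq_mul_div, Complex.mul_conj']
    push_cast
    rfl
  have happ : kernelFunctional μ hD f = ((∫ y, ‖D y‖ ^ 2 / (‖D y‖ + 1) ∂μ : ℝ) : ℂ) := by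
    rw [kernelFunctional_apply, ← integral_complex_ofReal]
    exact integral_congr_ae (Eventually.of_forall hval)
  have hint : Integrable (fun y => ‖D y‖ ^ 2 / (‖D y‖ + 1)) μ := by
    refine hD.norm.mono' ((hDc.norm.pow 2).div (hDc.norm.add continuous_const)
      fun y => (hpos y).ne').aestronglyMeasurable (Eventually.of_forall fun y => ?_)
    rw [Real.norm_of_nonneg (by positivity), div_le_iff₀ (hpos y)]
    nlinarith [norm_nonneg (D y)]
  have hle : (∫ y, ‖D y‖ ∂μ) - 1 ≤ ∫ y, ‖D y‖ ^ 2 / (‖D y‖ + 1) ∂μ := by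
    have h1 : ∫ y, (‖D y‖ - 1) ∂μ = (∫ y, ‖D y‖ ∂μ) - 1 := by
      rw [integral_sub hD.norm (integrable_const _)]
      simp
    rw [← h1]
    refine integral_mono (hD.norm.sub (integrable_const _)) hint fun y => ?_
    simp only
    rw [le_div_iff₀ (hpos y)]
    nlinarith [norm_nonneg (D y)]
  calc (∫ y, ‖D y‖ ∂μ) - 1 ≤ ‖kernelFunctional μ hD f‖ := by
        rw [happ, Complex.norm_real]
        exact hle.trans (le_abs_self _)
    _ ≤ ‖kernelFunctional μ hD‖ * ‖f‖ := ContinuousLinearMap.le_opNorm _ _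
    _ ≤ ‖kernelFunctional μ hD‖ := mul_le_of_le_one_right (norm_nonneg _) hf

/-- If the `L¹` norms of kernels are unbounded then so are the values of the associated
functionals at some bounded continuous function. -/
theorem exists_unbounded_integral_mul_conj {D : ℕ → ℝ → ℂ} (hDc : ∀ n, Continuous (D n))
    (hD : ∀ n, Integrable (D n) μ)
    (hunb : ¬ BddAbove (Set.range fun n => ∫ y, ‖D n y‖ ∂μ)) :
    ∃ f : BoundedContinuousFunction ℝ ℂ,
      ¬ BddAbove (Set.range fun n => ‖∫ y, f y * (starRingEnd ℂ) (D n y) ∂μ‖) := by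
  by_contra! hbdd
  obtain ⟨C, hC⟩ := banach_steinhaus (g := fun n => kernelFunctional μ (hD n)) fun f => by
    obtain ⟨C, hC⟩ := hbdd f
    exact ⟨C, fun n => hC ⟨n, rfl⟩⟩
  refine hunb ⟨C + 1, ?_⟩
  rintro _ ⟨n, rfl⟩
  have := integral_norm_sub_one_le_norm_kernelFunctional (hDc n) (hD n)
  have := hC n
  simp only at this ⊢
  linarith

end Divergence

end MockFourier

theorem theorem2p3 (R : ℕ) (hR : 1 < R) (B L : Finset ℤ)
    (hBL : MockFourier.IsHadamardPair R B L)
    (μ : MeasureTheory.Measure ℝ) [MeasureTheory.IsProbabilityMeasure μ]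
    (hμ : MockFourier.IsInvariantMeasure R B μ)
    (hΔ : 1 < MockFourier.geomMean μ (fun x => (B.card : ℂ) * MockFourier.mask L x)) :
    (∀ ρ : ℝ, 1 < ρ →
      ρ < MockFourier.geomMean μ (fun x => (B.card : ℂ) * MockFourier.mask L x) →
      ∃ C : ℝ, 0 < C ∧ ∀ᶠ n : ℕ in Filter.atTop,
        C * ρ ^ n ≤ ∫ x, ‖MockFourier.dirichlet R B L n x‖ ∂μ) ∧
    ∃ f : ℝ → ℂ, ContinuousOn f (MockFourier.attractor R B) ∧ MeasureTheory.Integrable f μ ∧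
      ¬ BddAbove (Set.range fun n : ℕ => ‖MockFourier.partialSum R B L μ n f 0‖) := by
  have hgrowth := fun ρ (h1 : 1 < ρ) h2 =>
    MockFourier.exists_mul_pow_le_integral_dirichlet hR hBL hμ hΔ (ρ := ρ) h1 h2
  refine ⟨hgrowth, ?_⟩
  obtain ⟨ρ, h1, h2⟩ := exists_between hΔ
  obtain ⟨C, hC, hev⟩ := hgrowth ρ h1 h2
  have hunb : ¬ BddAbove (Set.range fun n => ∫ y, ‖MockFourier.dirichlet R B L n y‖ ∂μ) := by
    rintro ⟨M, hM⟩
    have ht : Tendsto (fun n : ℕ => C * ρ ^ n) atTop atTop :=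
      (tendsto_pow_atTop_atTop_of_one_lt h1).const_mul_atTop hC
    obtain ⟨n, hn, hn'⟩ := (hev.and (ht.eventually_gt_atTop M)).exists
    exact absurd (hM ⟨n, rfl⟩) (not_le.2 (hn'.trans_le hn))
  have hDi : ∀ n, Integrable (MockFourier.dirichlet R B L n) μ := fun n =>
    MockFourier.integrable_dirichlet hR hBL n
  obtain ⟨f, hf⟩ := MockFourier.exists_unbounded_integral_mul_conj
    (MockFourier.continuous_dirichlet hR hBL) hDi hunb
  have hfi : Integrable f μ := f.integrable μ
  refine ⟨f, f.continuous.continuousOn, hfi, ?_⟩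
  simpa only [MockFourier.partialSum_zero hR hBL _ hfi] using hf
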